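/- Let $n\ge 1$. Write $[n]=\{1,\dots,n\}$ and let $\mathcal{S}_n$ be the set of permutations of $[n]$, written in one-line notation $\pi=\pi(1)\pi(2)\cdots\pi(n)$. An $n$-cycle is a permutation in $\mathcal{S}_n$ consisting of one single cycle of length $n$ (for $n=1$, the identity). The descent set of a sequence of integers $a=a_1a_2\cdots a_n$ is $D(a)=\{i : 1\le i\le n-1,\ a_i>a_{i+1}\}$. Let $\mathcal{U}_n$ be the set of sequences obtained from the one-line notation $\pi(1)\pi(2)\cdots\pi(n)$ of an $n$-cycle $\pi$ by replacing exactly one entry with $n+1$. Then there is a bijection $\varphi:\mathcal{U}_n\to\mathcal{S}_n$ such that, for every $\tau\in\mathcal{U}_n$ and $\sigma=\varphi(\tau)$, $$D(\tau)=D(\sigma),$$ and, in addition, if $n+1$ is in position $k$ of $\tau$, then $\sigma(k)=n$. -/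

import Mathlib

/-- The permutations of `[n]` consisting of one single cycle of length `n`. Here `[n]` is modelled
by `Fin n`, the number `j` of `[n]` being the element of `Fin n` with value `j - 1`. For `n = 1`
this is the identity, written `(1)` in cycle form. -/
def cyclicPerms (n : ℕ) : Set (Equiv.Perm (Fin n)) :=
  {π | π.IsCycleOn Set.univ}

/-- The one-line notation `π(1) π(2) … π(n)`, with entries in `{1, …, n}`. -/
def oneLine {n : ℕ} (π : Equiv.Perm (Fin n)) : Fin n → ℤ :=
  fun i => ((π i : ℕ) : ℤ) + 1

/-- The descent set `{i : 1 ≤ i ≤ n - 1, a_i > a_{i+1}}` of a sequence `a = a_1 a_2 … a_n` of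
integers. The entry `a_i` is the value of `a` at the index `i - 1` of `Fin n`. -/
def descentSet {n : ℕ} (a : Fin n → ℤ) : Set ℕ :=
  {i | ∃ (_ : 1 ≤ i) (h : i < n), a ⟨i - 1, by omega⟩ > a ⟨i, h⟩}

/-- The sequences obtained from the one-line notation of an `n`-cycle by replacing one entry
with `n + 1`. -/
def cyclesWithEntryReplaced (n : ℕ) : Set (Fin n → ℤ) :=
  {τ | ∃ π ∈ cyclicPerms n, ∃ k : Fin n, τ = Function.update (oneLine π) k ((n : ℤ) + 1)}

/-
A cycle notation `(y 0, …, y m)` with its last arrow redirected to a new maximum `⊤` runs through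
`cyclesWithEntryReplaced` exactly once. So it suffices that these sequences and the permutations
are equidistributed for the pair (descent set, position of the maximum), and by Möbius inversion
one may count the sequences with descent set contained in `s`, that is, those increasing on the
blocks into which `s` cuts `[n]`. Let `c` be the block index. For permutations these are the
stable sortings of the rearrangements `w` of `c`. For cycle notations they also correspond to the
rearrangements `w = c ∘ y`: as in the Gessel–Reutenauer bijection, comparing two entries of `y`
amounts to comparing the suffixes of `w` at their positions lexicographically, so `y` is
recovered from `w` as the ranking of its suffixes.
-/

open Finset Equiv

theorem toLex_nat_lt_iff {α : Type*} [LT α] (u v : ℕ → α) :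
    toLex u < toLex v ↔
      u 0 < v 0 ∨ u 0 = v 0 ∧ toLex (fun j => u (j + 1)) < toLex (fun j => v (j + 1)) := by
  constructor
  · rintro ⟨_ | i, heq, hlt⟩
    · exact Or.inl hlt
    · exact Or.inr ⟨heq 0 i.succ_pos, i, fun j hj => heq (j + 1) (Nat.succ_lt_succ hj), hlt⟩
  · rintro (h | ⟨h0, i, heq, hlt⟩)
    · exact ⟨0, fun j hj => absurd hj j.not_lt_zero, h⟩
    · refine ⟨i + 1, fun j hj => ?_, hlt⟩
      cases j with
      | zero => exact h0
      | succ j => exact heq j (Nat.lt_of_succ_lt_succ hj)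

section Words

variable {n : ℕ} {α : Type*}

/-- The word `w` followed by infinitely many letters `⊤`. -/
def extendTop (w : Fin n → α) (i : ℕ) : WithTop α :=
  if h : i < n then w ⟨i, h⟩ else ⊤

theorem extendTop_val (w : Fin n → α) (i : Fin n) : extendTop w i = w i := by
  simp [extendTop]

theorem extendTop_eq_top_iff {w : Fin n → α} {i : ℕ} : extendTop w i = ⊤ ↔ n ≤ i := by
  simp [extendTop]

theorem injOn_extendTop {w : Fin n → α} (hw : Function.Injective w) :
    Set.InjOn (extendTop w) (Set.Iic n) := by
  intro i hi j hj h
  rcases lt_or_eq_of_le (Set.mem_Iic.1 hi) with hin | rfl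
  · have hjn : j < n := by
      rwa [← not_le, ← extendTop_eq_top_iff (w := w), ← h, extendTop_eq_top_iff, not_le]
    lift i to Fin n using hin
    lift j to Fin n using hjn
    rw [extendTop_val, extendTop_val, WithTop.coe_inj] at h
    rw [hw h]
  · rw [extendTop_eq_top_iff.2 le_rfl, eq_comm, extendTop_eq_top_iff] at h
    exact le_antisymm h hj

/-- The suffix of the word `w` starting at the index `i`, extended by letters `⊤`. Suffixes are
compared lexicographically, and the end of the word counts as larger than all letters. -/
def suffix (w : Fin n → α) (i : ℕ) : Lex (ℕ → WithTop α) :=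
  toLex fun j => extendTop w (i + j)

theorem suffix_lt_suffix_iff [LT α] (w : Fin n → α) (i j : ℕ) :
    suffix w i < suffix w j ↔ extendTop w i < extendTop w j ∨
      extendTop w i = extendTop w j ∧ suffix w (i + 1) < suffix w (j + 1) := by
  unfold suffix
  rw [toLex_nat_lt_iff]
  simp only [Nat.add_zero, Nat.add_right_comm _ 1, Nat.add_assoc]

theorem suffix_injective (w : Fin n → α) : Function.Injective fun i : Fin n => suffix w i := by
  intro i j h
  have extendTop_eq (l : ℕ) : extendTop w (i + l) = extendTop w (j + l) :=
    congrFun (congrArg ofLex h) l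
  have hij : n ≤ j + (n - i) := by
    rw [← extendTop_eq_top_iff (w := w), ← extendTop_eq, extendTop_eq_top_iff]
    lia
  have hji : n ≤ i + (n - j) := by
    rw [← extendTop_eq_top_iff (w := w), extendTop_eq, extendTop_eq_top_iff]
    lia
  lia

variable [LinearOrder α]

theorem suffix_eq_top_iff {w : Fin n → α} {i : ℕ} : suffix w i = ⊤ ↔ n ≤ i := by
  constructor
  · intro h
    exact extendTop_eq_top_iff.1 (congrFun (congrArg ofLex h) 0)
  · intro h
    exact congrArg toLex (funext fun j => extendTop_eq_top_iff.2 (h.trans (i.le_add_right j)))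

theorem suffix_lt_top_iff {w : Fin n → α} {i : ℕ} : suffix w i < ⊤ ↔ i < n :=
  lt_top_iff_ne_top.trans (suffix_eq_top_iff.not.trans not_le)

/-- The permutation sending each index to the rank, in lexicographic order, of the suffix of `w`
starting there. -/
noncomputable def suffixRank (w : Fin n → α) : Perm (Fin n) :=
  (Tuple.sort fun i : Fin n => suffix w i)⁻¹

theorem suffixRank_lt_iff (w : Fin n → α) (i j : Fin n) :
    suffixRank w i < suffixRank w j ↔ suffix w i < suffix w j := by
  have hmono : StrictMono ((fun i : Fin n => suffix w i) ∘ ⇑(suffixRank w)⁻¹) :=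
    Monotone.strictMono_of_injective (by simpa [suffixRank] using Tuple.monotone_sort _)
      ((suffix_injective w).comp (suffixRank w)⁻¹.injective)
  have h := hmono.lt_iff_lt (a := suffixRank w i) (b := suffixRank w j)
  simp only [Function.comp_apply, Perm.inv_def, symm_apply_apply] at h
  exact h.symm

theorem suffixRank_eq_of_forall_lt {w : Fin n → α} {y : Perm (Fin n)}
    (h : ∀ i j, y i < y j → suffix w i < suffix w j) : suffixRank w = y := by
  have hmono : StrictMono ((fun i : Fin n => suffix w i) ∘ ⇑y⁻¹) := fun i j hij =>
    h _ _ (by simpa using hij)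
  rw [suffixRank, inv_eq_iff_eq_inv, eq_comm, Tuple.eq_sort_iff]
  exact ⟨hmono.monotone, fun i j hij heq => absurd heq (hmono hij).ne⟩

theorem extendTop_suffixRank_lt_iff (w : Fin n → α) (i j : ℕ) :
    extendTop (suffixRank w) i < extendTop (suffixRank w) j ↔ suffix w i < suffix w j := by
  rcases le_or_gt n i with hi | hi
  · rw [extendTop_eq_top_iff.2 hi, suffix_eq_top_iff.2 hi]
    exact iff_of_false not_top_lt not_top_lt
  rcases le_or_gt n j with hj | hj
  · rw [extendTop_eq_top_iff.2 hj, suffix_eq_top_iff.2 hj, suffix_lt_top_iff, lt_top_iff_ne_top,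
      Ne, extendTop_eq_top_iff, not_le]
  lift i to Fin n using hi
  lift j to Fin n using hj
  rw [extendTop_val, extendTop_val, WithTop.coe_lt_coe, suffixRank_lt_iff]

theorem monotone_comp_suffixRank_inv (w : Fin n → α) : Monotone (w ∘ ⇑(suffixRank w)⁻¹) := by
  refine monotone_iff_forall_lt.2 fun i j hij => ?_
  have h : suffix w ((suffixRank w)⁻¹ i : Fin n) < suffix w ((suffixRank w)⁻¹ j : Fin n) := by
    rw [← suffixRank_lt_iff]
    simpa using hij
  rw [suffix_lt_suffix_iff, extendTop_val, extendTop_val, WithTop.coe_lt_coe, WithTop.coe_inj] at h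
  exact h.elim le_of_lt fun h => h.1.le

end Words

section CutCycle

variable {n m : ℕ}

/-- The cyclic permutation with cycle notation `(y 0, y 1, …, y (n - 1))`, except that the last
entry is sent to `⊤`. -/
def cutCycle (y : Perm (Fin n)) (i : Fin n) : WithTop (Fin n) :=
  extendTop y (y⁻¹ i + 1)

theorem cutCycle_apply (y : Perm (Fin n)) (i : Fin n) :
    cutCycle y (y i) = extendTop y (i + 1) := by
  simp [cutCycle]

theorem cutCycle_injective (y : Perm (Fin n)) : Function.Injective (cutCycle y) := fun i j h =>
  y⁻¹.injective <| Fin.ext <| Nat.succ_injective <|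
    injOn_extendTop y.injective (y⁻¹ i).isLt (y⁻¹ j).isLt h

theorem cutCycle_apply_castSucc (y : Perm (Fin (m + 1))) (i : Fin m) :
    cutCycle y (y i.castSucc) = y i.succ := by
  rw [cutCycle_apply, ← extendTop_val, Fin.val_succ, Fin.val_castSucc]

theorem cutCycle_apply_last (y : Perm (Fin (m + 1))) : cutCycle y (y (Fin.last m)) = ⊤ := by
  rw [cutCycle_apply, extendTop_eq_top_iff, Fin.val_last]

theorem cutCycle_eq_top_iff {y : Perm (Fin (m + 1))} {k : Fin (m + 1)} :
    cutCycle y k = ⊤ ↔ y (Fin.last m) = k := by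
  rw [← cutCycle_apply_last y, (cutCycle_injective y).eq_iff, eq_comm]

theorem cutCycle_left_injective :
    Function.Injective (cutCycle : Perm (Fin (m + 1)) → Fin (m + 1) → _) := by
  intro y z h
  ext1 i
  induction i using Fin.reverseInduction with
  | last => rw [eq_comm, ← cutCycle_eq_top_iff, ← h, cutCycle_apply_last]
  | cast i ih =>
    refine cutCycle_injective z ?_
    rw [← h, cutCycle_apply_castSucc, ih, h, cutCycle_apply_castSucc]

end CutCycle

section Fibers

/-- The sequence `a` is strictly increasing on every fibre of `c`. When `c` is monotone, its
fibres are the blocks of a composition. -/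
def StrictMonoOnFibers {ι κ α : Type*} [LT ι] [LT α] (c : ι → κ) (a : ι → α) : Prop :=
  ∀ ⦃i j⦄, i < j → c i = c j → a i < a j

namespace StrictMonoOnFibers

theorem comp_iff {ι κ α β : Type*} [LT ι] [LinearOrder α] [Preorder β] {c : ι → κ} {a : ι → α}
    {f : α → β} (hf : StrictMono f) : StrictMonoOnFibers c (f ∘ a) ↔ StrictMonoOnFibers c a := by
  simp only [StrictMonoOnFibers, Function.comp_apply, hf.lt_iff_lt]

theorem eq_of_isMax {ι κ α β : Type*} [LinearOrder ι] [Preorder α] [Preorder β] {c : ι → κ}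
    {a : ι → α} {b : ι → β} (ha : StrictMonoOnFibers c a) (hb : StrictMonoOnFibers c b) {i j : ι}
    (hi : IsMax (a i)) (hj : IsMax (b j)) (h : c i = c j) : i = j :=
  eq_of_le_of_ge (not_lt.1 fun hji => hj.not_lt (hb hji h.symm))
    (not_lt.1 fun hij => hi.not_lt (ha hij h))

end StrictMonoOnFibers

theorem strictMonoOnFibers_iff_of_monotone {m : ℕ} {κ α : Type*} [PartialOrder κ] [Preorder α]
    {c : Fin (m + 1) → κ} (hc : Monotone c) {a : Fin (m + 1) → α} :
    StrictMonoOnFibers c a ↔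
      ∀ i : Fin m, c i.castSucc = c i.succ → a i.castSucc < a i.succ := by
  refine ⟨fun h i => h i.castSucc_lt_succ, fun h i j hij hcij => ?_⟩
  refine strictMonoOn_of_lt_succ (Set.ordConnected_singleton.preimage_mono hc)
    (s := c ⁻¹' {c j}) (fun k hk hkj hskj => ?_) hcij rfl hij
  have hk_last : k ≠ Fin.last m := fun hlast => hk (hlast ▸ isMax_top)
  obtain ⟨k, rfl⟩ := Fin.eq_castSucc_of_ne_last hk_last
  rw [Fin.orderSucc_castSucc] at hskj ⊢
  exact h k (hkj.trans hskj.symm)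

theorem comp_inv_eq_of_monotone {n : ℕ} {κ : Type*} [PartialOrder κ] {c : Fin n → κ}
    (hc : Monotone c) {σ ρ : Perm (Fin n)} (h : Monotone ((c ∘ σ) ∘ ρ)) : c ∘ ⇑ρ⁻¹ = c ∘ σ := by
  have hcomp : c ∘ ⇑(σ * ρ) = c ∘ ⇑(1 : Perm (Fin n)) := Tuple.unique_monotone h hc
  ext i
  simpa using (congrFun hcomp (ρ⁻¹ i)).symm

variable {n : ℕ} {κ : Type*} [LinearOrder κ] {c : Fin n → κ}

theorem suffix_comp_lt_of_extendTop_lt (hc : Monotone c) {y : Perm (Fin n)}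
    (hy : StrictMonoOnFibers c (cutCycle y)) (i j : ℕ) (h : extendTop y i < extendTop y j) :
    suffix (c ∘ y) i < suffix (c ∘ y) j := by
  induction hd : n - i generalizing i j with
  | zero => exact absurd (extendTop_eq_top_iff.2 (by lia)) h.ne_top
  | succ d ih =>
    rcases le_or_gt n j with hj | hj
    · rw [suffix_eq_top_iff.2 hj, suffix_lt_top_iff]
      lia
    lift i to Fin n using by lia
    lift j to Fin n using hj
    rw [extendTop_val, extendTop_val, WithTop.coe_lt_coe] at h
    rw [suffix_lt_suffix_iff, extendTop_val, extendTop_val, WithTop.coe_lt_coe, WithTop.coe_inj]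
    refine (hc h.le).lt_or_eq.imp_right fun heq => ⟨heq, ih _ _ ?_ (by lia)⟩
    simpa only [cutCycle_apply] using hy h heq

theorem suffixRank_comp_eq_iff (hc : Monotone c) {y : Perm (Fin n)} :
    suffixRank (c ∘ y) = y ↔ StrictMonoOnFibers c (cutCycle y) := by
  constructor
  · intro h i j hij hcij
    have key := extendTop_suffixRank_lt_iff (c ∘ y)
    rw [h] at key
    obtain ⟨i, rfl⟩ := y.surjective i
    obtain ⟨j, rfl⟩ := y.surjective j
    rw [← WithTop.coe_lt_coe, ← extendTop_val, ← extendTop_val, key, suffix_lt_suffix_iff,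
      extendTop_val, extendTop_val, Function.comp_apply, Function.comp_apply, hcij] at hij
    rw [cutCycle_apply, cutCycle_apply, key]
    exact (hij.resolve_left (lt_irrefl _)).2
  · intro hy
    refine suffixRank_eq_of_forall_lt fun i j hij =>
      suffix_comp_lt_of_extendTop_lt hc hy i j ?_
    rwa [extendTop_val, extendTop_val, WithTop.coe_lt_coe]

theorem sort_comp_inv_eq_iff (hc : Monotone c) {σ : Perm (Fin n)} :
    Tuple.sort (c ∘ ⇑σ⁻¹) = σ ↔ StrictMonoOnFibers c σ := by
  have hcomp : (c ∘ ⇑σ⁻¹) ∘ ⇑σ = c := by ext; simp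
  rw [eq_comm, Tuple.eq_sort_iff, hcomp, and_iff_right hc]
  simp [StrictMonoOnFibers]

theorem comp_sort_inv (hc : Monotone c) (σ : Perm (Fin n)) :
    c ∘ ⇑(Tuple.sort (c ∘ σ))⁻¹ = c ∘ σ :=
  comp_inv_eq_of_monotone hc (Tuple.monotone_sort (c ∘ σ))

theorem comp_suffixRank (hc : Monotone c) (σ : Perm (Fin n)) :
    c ∘ suffixRank (c ∘ σ) = c ∘ σ := by
  simpa using comp_inv_eq_of_monotone hc (monotone_comp_suffixRank_inv (c ∘ σ))

open Classical in
theorem card_strictMonoOnFibers_cutCycle {m : ℕ} {c : Fin (m + 1) → κ} (hc : Monotone c)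
    (k : Fin (m + 1)) :
    #{y : Perm (Fin (m + 1)) | StrictMonoOnFibers c (cutCycle y) ∧ y (Fin.last m) = k} =
      #{σ : Perm (Fin (m + 1)) | StrictMonoOnFibers c σ ∧ σ⁻¹ (Fin.last m) = k} := by
  have position_eq {y σ : Perm (Fin (m + 1))} (hy : StrictMonoOnFibers c (cutCycle y))
      (hσ : StrictMonoOnFibers c σ) (h : c ∘ ⇑σ⁻¹ = c ∘ y) :
      σ⁻¹ (Fin.last m) = y (Fin.last m) :=
    hσ.eq_of_isMax hy (by simp [Fin.top_eq_last]) (by simp [cutCycle_apply_last])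
      (congrFun h (Fin.last m))
  refine card_nbij' (fun y => Tuple.sort (c ∘ y)) (fun σ => suffixRank (c ∘ ⇑σ⁻¹))
    (fun y hmem => ?_) (fun σ hmem => ?_) (fun y hmem => ?_) (fun σ hmem => ?_)
  · obtain ⟨hy, rfl⟩ := (mem_filter_univ _).1 hmem
    have hsort : StrictMonoOnFibers c (Tuple.sort (c ∘ y)) := by
      rw [← sort_comp_inv_eq_iff hc, comp_sort_inv hc]
    exact (mem_filter_univ _).2 ⟨hsort, position_eq hy hsort (comp_sort_inv hc y)⟩
  · obtain ⟨hσ, rfl⟩ := (mem_filter_univ _).1 hmem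
    have hrank : StrictMonoOnFibers c (cutCycle (suffixRank (c ∘ ⇑σ⁻¹))) := by
      rw [← suffixRank_comp_eq_iff hc, comp_suffixRank hc]
    exact (mem_filter_univ _).2
      ⟨hrank, (position_eq hrank hσ (comp_suffixRank hc σ⁻¹).symm).symm⟩
  · obtain ⟨hy, -⟩ := (mem_filter_univ _).1 hmem
    simpa only [comp_sort_inv hc] using (suffixRank_comp_eq_iff hc).2 hy
  · obtain ⟨hσ, -⟩ := (mem_filter_univ _).1 hmem
    simpa only [comp_suffixRank hc] using (sort_comp_inv_eq_iff hc).2 hσ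

end Fibers

section Equidistribution

variable {α β P : Type*} [PartialOrder P] [OrderBot P] [LocallyFiniteOrder P]
  [DecidableLE P]

theorem card_filter_le_eq_sum [DecidableEq P] (A : Finset α) (f : α → P) (s : P) :
    (#{a ∈ A | f a ≤ s} : ℤ) = ∑ t ∈ Iic s, (#{a ∈ A | f a = t} : ℤ) := by
  simpa using congrArg (Nat.cast : ℕ → ℤ) (sum_card_fiberwise_eq_card_filter A (Iic s) f).symm

theorem card_filter_eq_of_card_filter_le [DecidableEq P] {A : Finset α} {B : Finset β} {f : α → P}
    {g : β → P} (h : ∀ s, #{a ∈ A | f a ≤ s} = #{b ∈ B | g b ≤ s}) (s : P) :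
    #{a ∈ A | f a = s} = #{b ∈ B | g b = s} := by
  have hA := IncidenceAlgebra.moebius_inversion_bot _ _ (card_filter_le_eq_sum A f) s
  have hB := IncidenceAlgebra.moebius_inversion_bot _ _ (card_filter_le_eq_sum B g) s
  simp only [h] at hA
  exact_mod_cast hA.trans hB.symm

theorem exists_equiv_of_card_filter_eq {γ : Type*} [Fintype α] [Fintype β] [DecidableEq γ]
    {f : α → γ} {g : β → γ} (h : ∀ c, #{a | f a = c} = #{b | g b = c}) :
    ∃ e : α ≃ β, ∀ a, g (e a) = f a := by
  have hfiber (c : γ) : Nonempty ({a // f a = c} ≃ {b // g b = c}) := by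
    rw [← Fintype.card_eq, Fintype.card_subtype, Fintype.card_subtype, h]
  exact ⟨ofFiberEquiv fun c => (hfiber c).some, ofFiberEquiv_map _⟩

theorem exists_equiv_of_card_filter_le {κ : Type*} [Fintype α] [Fintype β] [DecidableEq κ]
    {f : α → P} {g : β → P} {p : α → κ} {q : β → κ}
    (h : ∀ s k, #{a | f a ≤ s ∧ p a = k} = #{b | g b ≤ s ∧ q b = k}) :
    ∃ e : α ≃ β, ∀ a, g (e a) = f a ∧ q (e a) = p a := by
  classical
  obtain ⟨e, he⟩ := exists_equiv_of_card_filter_eq (f := fun a => (f a, p a))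
    (g := fun b => (g b, q b)) fun ⟨s, k⟩ => by
      have hk := card_filter_eq_of_card_filter_le (A := {a | p a = k}) (B := {b | q b = k})
        (f := f) (g := g) (fun t => by simpa only [filter_filter, and_comm] using h t k) s
      simpa only [filter_filter, Prod.mk.injEq, and_comm] using hk
  exact ⟨e, fun a => Prod.mk.inj (he a)⟩

end Equidistribution

section Descents

variable {n m : ℕ}

theorem finite_descentSet (a : Fin n → ℤ) : (descentSet a).Finite :=
  (Set.finite_lt_nat n).subset fun _ ⟨_, h, _⟩ => h

theorem descentSet_subset_iff {a : Fin (m + 1) → ℤ} {s : Set ℕ} :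
    descentSet a ⊆ s ↔ ∀ i : Fin m, (i + 1 : ℕ) ∉ s → a i.castSucc ≤ a i.succ := by
  constructor
  · intro h i his
    by_contra! hgt
    exact his (h ⟨by lia, by lia, hgt⟩)
  · rintro h i ⟨hi, him, hgt⟩
    obtain ⟨i, rfl⟩ := Nat.exists_eq_add_of_le' hi
    by_contra his
    exact (h ⟨i, by lia⟩ his).not_gt hgt

/-- The index of the block containing `i` when `Fin n` is cut in front of every element of `s`. -/
def blockIndex (s : Finset ℕ) (i : Fin n) : ℕ :=
  Nat.count (· ∈ s) (i + 1)

theorem monotone_blockIndex (s : Finset ℕ) : Monotone (blockIndex s : Fin n → ℕ) :=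
  fun _ _ hij => Nat.count_monotone _ (Nat.succ_le_succ hij)

theorem blockIndex_castSucc_eq_succ_iff {s : Finset ℕ} {i : Fin m} :
    blockIndex s i.castSucc = blockIndex s i.succ ↔ (i + 1 : ℕ) ∉ s := by
  rw [eq_comm]
  exact Nat.count_succ_eq_count_iff

theorem descentSet_subset_iff_strictMonoOnFibers {a : Fin (m + 1) → ℤ}
    (ha : Function.Injective a) {s : Finset ℕ} :
    descentSet a ⊆ s ↔ StrictMonoOnFibers (blockIndex s) a := by
  rw [descentSet_subset_iff, strictMonoOnFibers_iff_of_monotone (monotone_blockIndex s)]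
  refine forall_congr' fun i => ?_
  rw [blockIndex_castSucc_eq_succ_iff, mem_coe, (ha.ne i.castSucc_lt_succ.ne).le_iff_lt]

/-- The value in `{1, …, n + 1}` of an entry of a sequence, where `⊤` stands for `n + 1`. -/
def entryValue : WithTop (Fin n) → ℤ
  | ⊤ => n + 1
  | (i : Fin n) => i + 1

theorem entryValue_top : entryValue (⊤ : WithTop (Fin n)) = n + 1 := rfl

theorem entryValue_coe (i : Fin n) : entryValue (i : WithTop (Fin n)) = i + 1 := rfl

theorem strictMono_entryValue : StrictMono (entryValue (n := n)) := by
  intro x y hxy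
  lift x to Fin n using hxy.ne_top
  cases y with
  | top => simp [entryValue_coe, entryValue_top]
  | coe y => simpa [entryValue_coe] using hxy

theorem oneLine_eq_entryValue_comp (σ : Perm (Fin n)) :
    oneLine σ = (entryValue ∘ WithTop.some) ∘ σ := rfl

theorem exists_equiv_descentSet (m : ℕ) :
    ∃ e : Perm (Fin (m + 1)) ≃ Perm (Fin (m + 1)), ∀ y,
      descentSet (oneLine (e y)) = descentSet (entryValue ∘ cutCycle y) ∧
        (e y)⁻¹ (Fin.last m) = y (Fin.last m) := by
  classical
  have hmono : StrictMono (entryValue ∘ WithTop.some : Fin (m + 1) → ℤ) :=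
    strictMono_entryValue.comp WithTop.coe_strictMono
  have subset_iff_oneLine (σ : Perm (Fin (m + 1))) (s : Finset ℕ) :
      descentSet (oneLine σ) ⊆ s ↔ StrictMonoOnFibers (blockIndex s) σ := by
    rw [oneLine_eq_entryValue_comp,
      descentSet_subset_iff_strictMonoOnFibers (hmono.injective.comp σ.injective),
      StrictMonoOnFibers.comp_iff hmono]
  have subset_iff_cutCycle (y : Perm (Fin (m + 1))) (s : Finset ℕ) :
      descentSet (entryValue ∘ cutCycle y) ⊆ s ↔
        StrictMonoOnFibers (blockIndex s) (cutCycle y) := by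
    rw [descentSet_subset_iff_strictMonoOnFibers
        (strictMono_entryValue.injective.comp (cutCycle_injective y)),
      StrictMonoOnFibers.comp_iff strictMono_entryValue]
  obtain ⟨e, he⟩ := exists_equiv_of_card_filter_le
    (f := fun y => (finite_descentSet (entryValue ∘ cutCycle y)).toFinset)
    (g := fun σ => (finite_descentSet (oneLine σ)).toFinset)
    (p := fun y => y (Fin.last m)) (q := fun σ => σ⁻¹ (Fin.last m)) fun s k => by
      simpa only [Set.Finite.toFinset_subset, subset_iff_oneLine,
        subset_iff_cutCycle] using card_strictMonoOnFibers_cutCycle (monotone_blockIndex s) k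
  exact ⟨e, fun y => (he y).imp_left Set.Finite.toFinset_inj.1⟩

end Descents

section Cycles

variable {m : ℕ}

theorem finRotate_castSucc (i : Fin m) : finRotate (m + 1) i.castSucc = i.succ :=
  finRotate_of_lt i.isLt

theorem isCycleOn_finRotate (m : ℕ) : (finRotate (m + 1)).IsCycleOn Set.univ := by
  cases m with
  | zero =>
    have : Subsingleton (Fin (0 + 1)) := inferInstanceAs (Subsingleton (Fin 1))
    exact Perm.isCycleOn_of_subsingleton _ _
  | succ m =>
    have hmoved : {x | finRotate (m + 2) x ≠ x} = Set.univ := by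
      simp
    exact hmoved ▸ isCycle_finRotate.isCycleOn

theorem conj_finRotate_mem_cyclicPerms (y : Perm (Fin (m + 1))) :
    y * finRotate (m + 1) * y⁻¹ ∈ cyclicPerms (m + 1) := by
  simpa [cyclicPerms, Set.image_univ, y.surjective.range_eq] using
    (isCycleOn_finRotate m).conj (g := y)

theorem exists_conj_finRotate_eq {π : Perm (Fin (m + 1))} (hπ : π ∈ cyclicPerms (m + 1))
    (k : Fin (m + 1)) :
    ∃ y : Perm (Fin (m + 1)), y * finRotate (m + 1) * y⁻¹ = π ∧ y (Fin.last m) = k := by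
  have hcycle : π.IsCycleOn ((univ : Finset (Fin (m + 1))) : Set (Fin (m + 1))) := by
    rwa [coe_univ]
  have hsurj : Function.Surjective fun i : Fin (m + 1) => (π ^ (i + 1 : ℕ)) k := by
    intro b
    obtain ⟨l, hl, hb⟩ := hcycle.exists_pow_eq (mem_univ (π k)) (mem_univ b)
    exact ⟨⟨l, by simpa using hl⟩, by simpa [pow_succ] using hb⟩
  let y : Perm (Fin (m + 1)) := ofBijective _ (Finite.surjective_iff_bijective.1 hsurj)
  have hy (i : Fin (m + 1)) : y i = (π ^ (i + 1 : ℕ)) k := rfl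
  have hlast : y (Fin.last m) = k := by
    simpa [hy] using hcycle.pow_card_apply (mem_univ k)
  refine ⟨y, mul_inv_eq_of_eq_mul (Equiv.ext fun i => ?_), hlast⟩
  rw [Perm.mul_apply, Perm.mul_apply]
  cases i using Fin.lastCases with
  | last => rw [finRotate_last, hlast, hy, Fin.val_zero, zero_add, pow_one]
  | cast i =>
    rw [finRotate_castSucc, hy, hy, Fin.val_succ, Fin.val_castSucc, pow_succ' π (i + 1),
      Perm.mul_apply]

theorem entryValue_comp_cutCycle (y : Perm (Fin (m + 1))) :
    entryValue ∘ cutCycle y = Function.update (oneLine (y * finRotate (m + 1) * y⁻¹))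
      (y (Fin.last m)) (((m + 1 : ℕ) : ℤ) + 1) := by
  ext i
  obtain ⟨i, rfl⟩ := y.surjective i
  cases i using Fin.lastCases with
  | last => rw [Function.comp_apply, cutCycle_apply_last, entryValue_top, Function.update_self]
  | cast i =>
    rw [Function.comp_apply, cutCycle_apply_castSucc, entryValue_coe,
      Function.update_of_ne (y.injective.ne i.castSucc_lt_last.ne), oneLine, Perm.mul_apply,
      Perm.mul_apply, Perm.inv_def, symm_apply_apply, finRotate_castSucc]

theorem range_entryValue_comp_cutCycle :
    Set.range (fun y : Perm (Fin (m + 1)) => entryValue ∘ cutCycle y) =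
      cyclesWithEntryReplaced (m + 1) := by
  ext τ
  constructor
  · rintro ⟨y, rfl⟩
    exact ⟨_, conj_finRotate_mem_cyclicPerms y, _, entryValue_comp_cutCycle y⟩
  · rintro ⟨π, hπ, k, rfl⟩
    obtain ⟨y, rfl, rfl⟩ := exists_conj_finRotate_eq hπ k
    exact ⟨y, entryValue_comp_cutCycle y⟩

/-- Every `n`-cycle with an entry replaced is a cut cycle, for a unique cycle notation. -/
noncomputable def cutCycleEquiv (m : ℕ) :
    Perm (Fin (m + 1)) ≃ cyclesWithEntryReplaced (m + 1) :=
  (ofInjective (fun y => entryValue ∘ cutCycle y)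
    (strictMono_entryValue.injective.comp_left.comp cutCycle_left_injective)).trans
    (setCongr range_entryValue_comp_cutCycle)

theorem coe_cutCycleEquiv (y : Perm (Fin (m + 1))) :
    (cutCycleEquiv m y : Fin (m + 1) → ℤ) = entryValue ∘ cutCycle y := rfl

end Cycles

theorem corollary2 (n : ℕ) (hn : 1 ≤ n) :
    ∃ φ : cyclesWithEntryReplaced n → Equiv.Perm (Fin n),
      Function.Bijective φ ∧
      ∀ τ : cyclesWithEntryReplaced n,
        descentSet (τ : Fin n → ℤ) = descentSet (oneLine (φ τ)) ∧
        ∀ k : Fin n, (τ : Fin n → ℤ) k = (n : ℤ) + 1 → oneLine (φ τ) k = (n : ℤ) := by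
  obtain ⟨m, rfl⟩ := Nat.exists_eq_add_of_le' hn
  obtain ⟨e, he⟩ := exists_equiv_descentSet m
  refine ⟨(cutCycleEquiv m).symm.trans e, Equiv.bijective _, fun τ => ?_⟩
  obtain ⟨y, rfl⟩ := (cutCycleEquiv m).surjective τ
  rw [trans_apply, symm_apply_apply, coe_cutCycleEquiv]
  refine ⟨(he y).1.symm, fun k hk => ?_⟩
  have hcut : cutCycle y k = ⊤ := strictMono_entryValue.injective (hk.trans entryValue_top.symm)
  have hmax : e y k = Fin.last m := by
    rw [← cutCycle_eq_top_iff.1 hcut, ← (he y).2, Perm.inv_def, apply_symm_apply]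
  simp [oneLine, hmax]
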